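/- Let $\mathbb K$ be an algebraically closed field of arbitrary characteristic and let $n$ be a natural number. For a finite set $S$ of variables let $HD^k$ be the $k$-th Hasse--Schmidt derivation, i.e. the $\mathbb K$-linear map on $\mathbb K[x_s : s\in S]$ with $$HD^k\Big(\prod_{s} x_s^{\alpha_s}\Big)=\sum_{\sum_s j_s=k}\ \prod_{s}\binom{\alpha_s}{j_s}x_s^{\alpha_s-j_s}.$$ For $1\le j\le n$ let $\mathfrak p^j_n:\mathbb A^n(\mathbb K)\to\mathbb A^n(\mathbb K)$ be the shift projection $(x_1,\dots,x_n)\mapsto(x_1-x_j,\dots,x_n-x_j)$ onto the hyperplane $x_j=0$, and let $V^j_k\subseteq\mathbb A^n(\mathbb K)$ be the set of points with $x_j=0$ at which the polynomial $HD^{k}\big(\prod_{l\ne j}x_l\big)\in\mathbb K[x_l : l\neq j]$ vanishes. For $1\le i\le n-1$ let $$X^i_n(\mathbb K)=\bigcup_{j=1}^n(\mathfrak p^j_n)^{-1}\big(V^j_{i-1}\big)\subseteq\mathbb A^n(\mathbb K)$$ be the $i$-th discriminant hypersurface, and put $Y=\bigcap_{i=1}^{n-1}X^i_n(\mathbb K)$.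 Let $\Delta_n(\mathbb K)=\{(a,\dots,a):a\in\mathbb K\}$ be the diagonal. If the algebraic set $Y$ has dimension $2$ (Krull dimension of its coordinate ring), then: 1. $Y$ is the union of finitely many $2$-dimensional linear subspaces of $\mathbb A^n(\mathbb K)=\mathbb K^n$, each of which is spanned by the diagonal $\Delta_n(\mathbb K)$ and a point $\alpha\in Y\setminus\Delta_n(\mathbb K)$; 2. $Y$ is invariant under the action of the symmetric group $\mathfrak S_n$ on $\mathbb A^n(\mathbb K)$ by permutation of coordinates. -/

import Mathlib

namespace CasasAlvero

/-- The `i`-th multivariate Hasse--Schmidt derivation on the polynomial ring in the (finitely many)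
variables indexed by `σ`: the linear map sending the monomial `x ^ α` to
`∑_{|j| = i} (∏ k, binom (α k) (j k)) x ^ (α - j)`. When some `j k > α k` the coefficient
is zero, so the truncated subtraction of exponents is harmless. -/
noncomputable def hasseSchmidt (K : Type*) [Field K] (σ : Type*) [Fintype σ] [DecidableEq σ]
    (i : ℕ) : MvPolynomial σ K →ₗ[K] MvPolynomial σ K :=
  (MvPolynomial.basisMonomials σ K).constr K fun α : σ →₀ ℕ =>
    ∑ j ∈ Finset.finsuppAntidiag (Finset.univ : Finset σ) i,
      MvPolynomial.monomial (α - j) (∏ k, ((α k).choose (j k) : K))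

/-- The polynomial `HD^k (∏_{l ≠ j} x_l)` in the `n - 1` variables `x_l`, `l ≠ j`. -/
noncomputable def derivedMonomial (K : Type*) [Field K] (n : ℕ) (j : Fin n) (k : ℕ) :
    MvPolynomial {l : Fin n // l ≠ j} K :=
  hasseSchmidt K {l : Fin n // l ≠ j} k (∏ l : {l : Fin n // l ≠ j}, MvPolynomial.X l)

/-- The zero locus of `HD^k (∏_{l ≠ j} x_l)` in the coordinate hyperplane `x_j = 0`, regarded as a
subset of affine `n`-space. -/
def hyperplaneLocus (K : Type*) [Field K] (n : ℕ) (j : Fin n) (k : ℕ) : Set (Fin n → K) :=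
  {y | y j = 0 ∧
    MvPolynomial.eval (fun l : {l : Fin n // l ≠ j} => y l) (derivedMonomial K n j k) = 0}

/-- The `j`-th shift projection `(x_1, …, x_n) ↦ (x_1 - x_j, …, x_n - x_j)`, whose image is
the coordinate hyperplane `x_j = 0`. -/
def shiftProjection (K : Type*) [Field K] (n : ℕ) (j : Fin n) (x : Fin n → K) : Fin n → K :=
  fun l => x l - x j

/-- The `i`-th discriminant hypersurface of degree `n` (meaningful for `1 ≤ i ≤ n - 1`). -/
def discriminantHypersurface (K : Type*) [Field K] (n i : ℕ) : Set (Fin n → K) :=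
  ⋃ j : Fin n, shiftProjection K n j ⁻¹' hyperplaneLocus K n j (i - 1)

/-- The intersection of the discriminant hypersurfaces over all `1 ≤ i ≤ n - 1`. -/
def discriminantIntersection (K : Type*) [Field K] (n : ℕ) : Set (Fin n → K) :=
  ⋂ i ∈ Finset.Icc 1 (n - 1), discriminantHypersurface K n i

/-- The dimension of an algebraic subset of affine `n`-space: the Krull dimension of its
coordinate ring. -/
noncomputable def algebraicDim {K : Type*} [Field K] {n : ℕ} (V : Set (Fin n → K)) : WithBot ℕ∞ :=
  ringKrullDim (MvPolynomial (Fin n) K ⧸ MvPolynomial.vanishingIdeal K V)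

/-- The diagonal line in affine `n`-space. -/
def diagonal (K : Type*) [Field K] (n : ℕ) : Submodule K (Fin n → K) where
  carrier := {x | ∃ a : K, ∀ l, x l = a}
  add_mem' := by
    rintro x y ⟨a, ha⟩ ⟨b, hb⟩
    exact ⟨a + b, fun l => by rw [Pi.add_apply, ha, hb]⟩
  zero_mem' := ⟨0, fun _ => rfl⟩
  smul_mem' := by
    rintro c x ⟨a, ha⟩
    exact ⟨c * a, fun l => by rw [Pi.smul_apply, ha, smul_eq_mul]⟩

end CasasAlvero

/-! The polynomial `HD^k (∏ x_l)` is homogeneous and symmetric, and it is evaluated only at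
differences `x_l - x_j`. Hence `Y` is stable under scaling, under translation along the diagonal `Δ`
and under permutations, so it contains the plane `span {α} ⊔ Δ` for each `α ∈ Y \ Δ`. Only finitely
many such planes occur: a Noetherian ring has finitely many minimal primes over `I(Y)`, so among
infinitely many planes some `W` has `I(W)` not minimal, and `p < I(W) < I(Δ) < I(0)` forces
dimension at least 3 (`three_le_ringKrullDim_of_infinite_submodules`). Dimension 2 also rules out `Y
⊆ Δ`, so some plane exists and covers `Δ`. -/

/-! ### Vanishing ideals of linear subspaces -/

open MvPolynomial in
theorem vanishingIdeal_isPrime_of_submodule {K σ : Type*} [Field K] [Infinite K]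
    (W : Submodule K (σ → K)) :
    (vanishingIdeal K (W : Set (σ → K)) : Ideal (MvPolynomial σ K)).IsPrime := by
  refine ⟨fun h => ?_, fun {p q} hpq => ?_⟩
  · have := (Ideal.eq_top_iff_one _).1 h 0 W.zero_mem
    simp at this
  · by_contra! hcon
    obtain ⟨hp, hq⟩ := hcon
    simp only [mem_vanishingIdeal_iff, not_forall] at hp hq
    obtain ⟨u, hu, hpu⟩ := hp
    obtain ⟨v, hv, hqv⟩ := hq
    -- Restriction to the line through `u` and `v`, which stays in `W`. It maps into the domain
    -- `K[t]`, where a polynomial vanishing at every point of the infinite field is zero.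
    let φ : MvPolynomial σ K →ₐ[K] Polynomial K :=
      aeval fun i => Polynomial.C (u i) + Polynomial.X * Polynomial.C (v i - u i)
    have hφ (t : K) (r : MvPolynomial σ K) :
        (φ r).eval t = aeval (u + t • (v - u)) r := by
      rw [← Polynomial.coe_aeval_eq_eval]
      change ((Polynomial.aeval t).comp φ) r = _
      congr 1
      ext i
      simp [φ]
    have hprod : φ p * φ q = 0 := by
      apply Polynomial.funext
      intro t
      rw [← map_mul, hφ, Polynomial.eval_zero]
      exact hpq _ (W.add_mem hu (W.smul_mem _ (W.sub_mem hv hu)))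
    rcases mul_eq_zero.1 hprod with h | h
    · have := hφ 0 p
      simp only [h, Polynomial.eval_zero, zero_smul, add_zero] at this
      exact hpu this.symm
    · have := hφ 1 q
      simp only [h, Polynomial.eval_zero, one_smul, add_sub_cancel] at this
      exact hqv this.symm

open MvPolynomial in
theorem vanishingIdeal_le_iff_of_submodule {K σ : Type*} [Field K] [Finite σ]
    {V W : Submodule K (σ → K)} :
    (vanishingIdeal K (W : Set (σ → K)) : Ideal (MvPolynomial σ K)) ≤
      vanishingIdeal K (V : Set (σ → K)) ↔ V ≤ W := by
  classical
  have := Fintype.ofFinite σ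
  refine ⟨fun h x hx => ?_, fun h => vanishingIdeal_anti_mono h⟩
  by_contra hxW
  obtain ⟨f, hfx, hfW⟩ := W.exists_le_ker_of_notMem hxW
  -- The functional `f`, written as a linear form, separates `x` from `W`.
  let p : MvPolynomial σ K := ∑ i, C (f (Pi.single i 1)) * X i
  have hp (y : σ → K) : aeval y p = f y := by
    rw [LinearMap.pi_apply_eq_sum_univ f y]
    simp only [p, map_sum, map_mul, aeval_X, aeval_C, smul_eq_mul, Algebra.algebraMap_self,
      RingHom.id_apply]
    refine Finset.sum_congr rfl fun i _ => ?_
    rw [mul_comm]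
    congr 2
    ext j
    simp [Pi.single_apply, eq_comm]
  have hpW : p ∈ (vanishingIdeal K (W : Set (σ → K)) : Ideal (MvPolynomial σ K)) :=
    fun y hy => (hp y).trans (hfW hy)
  exact hfx ((hp x).symm.trans (h hpW x hx))

open MvPolynomial in
/-- If a set contains infinitely many linear subspaces, each properly containing a fixed nonzero
subspace `D`, then its coordinate ring has Krull dimension at least three. -/
theorem three_le_ringKrullDim_of_infinite_submodules {K σ : Type*} [Field K] [Infinite K]
    [Finite σ] {Y : Set (σ → K)} {D : Submodule K (σ → K)} (hD : D ≠ ⊥)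
    {T : Set (Submodule K (σ → K))} (hT : T.Infinite)
    (hTY : ∀ W ∈ T, (W : Set (σ → K)) ⊆ Y) (hDT : ∀ W ∈ T, D < W) :
    3 ≤ ringKrullDim (MvPolynomial σ K ⧸ vanishingIdeal K Y) := by
  let I (W : Submodule K (σ → K)) : Ideal (MvPolynomial σ K) :=
    vanishingIdeal K (W : Set (σ → K))
  have hI (W) : (I W).IsPrime := vanishingIdeal_isPrime_of_submodule W
  have hlt {V W : Submodule K (σ → K)} (h : V < W) : I W < I V :=
    lt_iff_le_not_ge.2 ⟨vanishingIdeal_le_iff_of_submodule.2 h.le,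
      fun h' => h.not_ge (vanishingIdeal_le_iff_of_submodule.1 h')⟩
  have hinj : Function.Injective I := fun V W h =>
    le_antisymm (vanishingIdeal_le_iff_of_submodule.1 h.ge)
      (vanishingIdeal_le_iff_of_submodule.1 h.le)
  have hYI (W) (hW : W ∈ T) : vanishingIdeal K Y ≤ I W := vanishingIdeal_anti_mono (hTY W hW)
  have hmin :=
    (vanishingIdeal K Y : Ideal (MvPolynomial σ K)).finite_minimalPrimes_of_isNoetherianRing
  -- Infinitely many distinct primes `I W` cannot all be minimal over `I(Y)`.
  obtain ⟨_, ⟨W, hW, rfl⟩, hWmin⟩ := ((hT.image hinj.injOn).sdiff hmin).nonempty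
  obtain ⟨p, hp, hpW⟩ := Ideal.exists_minimalPrimes_le (hYI W hW)
  have hpW' : p < I W := lt_of_le_of_ne hpW fun h => hWmin (h ▸ hp)
  rw [ringKrullDim_quotient]
  have h0 := hlt (bot_lt_iff_ne_bot.2 hD)
  have h1 := hlt (hDT W hW)
  have hpY := hp.1.2
  let s : LTSeries (PrimeSpectrum.zeroLocus
      ((vanishingIdeal K Y : Ideal (MvPolynomial σ K)) : Set (MvPolynomial σ K))) :=
    { length := 3
      toFun := ![⟨⟨p, hp.1.1⟩, hpY⟩, ⟨⟨I W, hI W⟩, hYI W hW⟩,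
        ⟨⟨I D, hI D⟩, (hYI W hW).trans h1.le⟩, ⟨⟨I ⊥, hI ⊥⟩, (hYI W hW).trans (h1.trans h0).le⟩]
      step := by
        intro i
        fin_cases i
        · exact hpW'
        · exact h1
        · exact h0 }
  exact Order.LTSeries.length_le_krullDim s

/-! ### Symmetries of the discriminant intersection -/

namespace CasasAlvero

theorem eval_hasseSchmidt_prod_X {K σ : Type*} [Field K] [Fintype σ] [DecidableEq σ] (k : ℕ)
    (y : σ → K) :
    MvPolynomial.eval y (hasseSchmidt K σ k (∏ l, MvPolynomial.X l)) =
      ∑ j ∈ Finset.finsuppAntidiag (Finset.univ : Finset σ) k,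
        (∏ l, ((Nat.choose 1 (j l) : ℕ) : K)) * ∏ l, y l ^ (1 - j l) := by
  have hX : (∏ l, MvPolynomial.X l : MvPolynomial σ K) =
      MvPolynomial.basisMonomials σ K (Finsupp.equivFunOnFinite.symm fun _ => 1) := by
    rw [MvPolynomial.coe_basisMonomials]
    simp [MvPolynomial.monomial_eq, Finsupp.prod_fintype]
  rw [hasseSchmidt, hX, Module.Basis.constr_basis, map_sum]
  refine Finset.sum_congr rfl fun j _ => ?_
  rw [MvPolynomial.eval_monomial, Finsupp.prod_fintype _ _ (by simp)]
  simp

theorem eval_hasseSchmidt_prod_X_smul {K σ : Type*} [Field K] [Fintype σ] [DecidableEq σ] {k : ℕ}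
    (y : σ → K) (c : K) :
    MvPolynomial.eval (c • y) (hasseSchmidt K σ k (∏ l, MvPolynomial.X l)) =
      c ^ (Fintype.card σ - k) *
        MvPolynomial.eval y (hasseSchmidt K σ k (∏ l, MvPolynomial.X l)) := by
  rw [eval_hasseSchmidt_prod_X, eval_hasseSchmidt_prod_X, Finset.mul_sum]
  refine Finset.sum_congr rfl fun j hj => ?_
  -- If all `j l ≤ 1`, the exponents `1 - j l` do not truncate and sum to the degree; otherwise a
  -- factor `choose 1 (j l)` kills the term.
  by_cases h : ∀ l, j l ≤ 1
  · have hsum : ∑ l, (1 - j l) = Fintype.card σ - k := by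
      rw [Finset.sum_tsub_distrib _ fun l _ => h l, (Finset.mem_finsuppAntidiag.1 hj).1]
      simp
    rw [← hsum, ← Finset.prod_pow_eq_pow_sum, mul_left_comm]
    simp only [Pi.smul_apply, smul_eq_mul, mul_pow, Finset.prod_mul_distrib]
  · push Not at h
    obtain ⟨l, hl⟩ := h
    have : ∏ l, ((Nat.choose 1 (j l) : ℕ) : K) = 0 :=
      Finset.prod_eq_zero (Finset.mem_univ l) (by rw [Nat.choose_eq_zero_of_lt hl, Nat.cast_zero])
    rw [this]
    simp

theorem eval_hasseSchmidt_prod_X_comp_equiv {K σ τ : Type*} [Field K] [Fintype σ] [DecidableEq σ]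
    [Fintype τ] [DecidableEq τ] (e : σ ≃ τ) (k : ℕ) (y : τ → K) :
    MvPolynomial.eval (y ∘ e) (hasseSchmidt K σ k (∏ l, MvPolynomial.X l)) =
      MvPolynomial.eval y (hasseSchmidt K τ k (∏ l, MvPolynomial.X l)) := by
  rw [eval_hasseSchmidt_prod_X, eval_hasseSchmidt_prod_X]
  refine Finset.sum_equiv (Finsupp.equivCongrLeft e) (fun j => ?_) (fun j _ => ?_)
  · simp only [Finset.mem_finsuppAntidiag, Finset.subset_univ, and_true,
      Finsupp.equivCongrLeft_apply, Finsupp.equivMapDomain_apply]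
    rw [← Equiv.sum_comp e]
    simp
  · congr 1 <;> refine Fintype.prod_equiv e _ _ fun l => ?_ <;> simp

theorem mem_discriminantIntersection_iff {K : Type*} [Field K] {n : ℕ} {x : Fin n → K} :
    x ∈ discriminantIntersection K n ↔ ∀ i ∈ Finset.Icc 1 (n - 1), ∃ j : Fin n,
      MvPolynomial.eval (fun l : {l : Fin n // l ≠ j} => x l - x j)
        (derivedMonomial K n j (i - 1)) = 0 := by
  simp [discriminantIntersection, discriminantHypersurface, hyperplaneLocus, shiftProjection]

theorem smul_add_mem_discriminantIntersection {K : Type*} [Field K] {n : ℕ} {x d : Fin n → K}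
    (hx : x ∈ discriminantIntersection K n) (c : K) (hd : d ∈ diagonal K n) :
    c • x + d ∈ discriminantIntersection K n := by
  obtain ⟨a, ha⟩ := hd
  rw [mem_discriminantIntersection_iff] at hx ⊢
  intro i hi
  obtain ⟨j, hj⟩ := hx i hi
  refine ⟨j, ?_⟩
  have : (fun l : {l : Fin n // l ≠ j} => (c • x + d) l - (c • x + d) j) =
      c • fun l : {l : Fin n // l ≠ j} => x l - x j := by
    ext l
    simp only [Pi.add_apply, Pi.smul_apply, smul_eq_mul, ha]
    ring
  rw [this, derivedMonomial, eval_hasseSchmidt_prod_X_smul]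
  rw [derivedMonomial] at hj
  rw [hj, mul_zero]

theorem comp_perm_mem_discriminantIntersection {K : Type*} [Field K] {n : ℕ} {x : Fin n → K}
    (hx : x ∈ discriminantIntersection K n) (τ : Equiv.Perm (Fin n)) :
    x ∘ τ ∈ discriminantIntersection K n := by
  rw [mem_discriminantIntersection_iff] at hx ⊢
  intro i hi
  obtain ⟨j, hj⟩ := hx i hi
  -- The base coordinate moves along: `(x ∘ τ) (τ⁻¹ j) = x j`.
  refine ⟨τ⁻¹ j, ?_⟩
  let e : {l : Fin n // l ≠ τ⁻¹ j} ≃ {l : Fin n // l ≠ j} :=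
    τ.subtypeEquiv fun l => by rw [ne_eq, ne_eq, Equiv.Perm.eq_inv_iff_eq]
  rw [derivedMonomial] at hj ⊢
  rw [← eval_hasseSchmidt_prod_X_comp_equiv e] at hj
  rw [← hj]
  congr 2
  ext l
  simp [e]

/-! ### The diagonal and the planes through it -/

theorem diagonal_eq_span (K : Type*) [Field K] (n : ℕ) :
    diagonal K n = Submodule.span K {fun _ => 1} := by
  ext x
  rw [Submodule.mem_span_singleton]
  constructor
  · rintro ⟨a, ha⟩
    exact ⟨a, by ext l; simp [ha]⟩
  · rintro ⟨a, rfl⟩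
    exact ⟨a, by simp⟩

theorem diagonal_ne_bot (K : Type*) [Field K] {n : ℕ} (hn : n ≠ 0) : diagonal K n ≠ ⊥ := by
  rw [diagonal_eq_span, Ne, Submodule.span_singleton_eq_bot]
  exact fun h => one_ne_zero (congrFun h ⟨0, Nat.pos_of_ne_zero hn⟩)

theorem finrank_span_sup_diagonal {K : Type*} [Field K] {n : ℕ} {α : Fin n → K}
    (hα : α ∉ diagonal K n) :
    Module.finrank K ↥(Submodule.span K {α} ⊔ diagonal K n) = 2 := by
  have hn : n ≠ 0 := by
    rintro rfl
    exact hα ⟨0, fun l => l.elim0⟩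
  have h1 : (fun _ => 1 : Fin n → K) ≠ 0 := fun h =>
    one_ne_zero (congrFun h ⟨0, Nat.pos_of_ne_zero hn⟩)
  have hli : LinearIndependent K ![fun _ => 1, α] := by
    rw [LinearIndependent.pair_iff' h1]
    intro a h
    exact hα ⟨a, fun l => by simp [← h]⟩
  rw [diagonal_eq_span, sup_comm, ← Submodule.span_union, Set.singleton_union,
    ← Matrix.range_cons_cons_empty _ _ ![], finrank_span_eq_card hli, Fintype.card_fin]

/-- All coordinate functions agree on the diagonal, so the coordinate ring is a quotient of `K[t]`.
-/
theorem algebraicDim_le_one_of_subset_diagonal {K : Type*} [Field K] {n : ℕ}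
    {V : Set (Fin n → K)} (hV : V ⊆ diagonal K n) : algebraicDim V ≤ 1 := by
  let I : Ideal (MvPolynomial (Fin n) K) := MvPolynomial.vanishingIdeal K V
  obtain ⟨a, ha⟩ : ∃ a, ∀ i, Ideal.Quotient.mkₐ K I (MvPolynomial.X i) = a := by
    rcases n with _ | n
    · exact ⟨0, fun i => i.elim0⟩
    · refine ⟨Ideal.Quotient.mk I (MvPolynomial.X 0), fun i => Ideal.Quotient.eq.2 fun x hx => ?_⟩
      obtain ⟨a, ha⟩ := hV hx
      simp [ha]
  let φ : Polynomial K →ₐ[K] MvPolynomial (Fin n) K ⧸ I := Polynomial.aeval a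
  have hφ : Function.Surjective φ := by
    rw [← AlgHom.range_eq_top, eq_top_iff]
    have htop : (Ideal.Quotient.mkₐ K I).range = ⊤ :=
      (AlgHom.range_eq_top _).2 (Ideal.Quotient.mkₐ_surjective K I)
    rw [← htop, ← Algebra.map_top, ← MvPolynomial.adjoin_range_X, AlgHom.map_adjoin,
      Algebra.adjoin_le_iff]
    rintro _ ⟨_, ⟨i, rfl⟩, rfl⟩
    exact ⟨Polynomial.X, (Polynomial.aeval_X a).trans (ha i).symm⟩
  exact (ringKrullDim_le_of_surjective φ.toRingHom hφ).trans
    (Ring.krullDimLE_iff.1 inferInstance)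

theorem span_sup_diagonal_subset {K : Type*} [Field K] {n : ℕ} {α : Fin n → K}
    (hα : α ∈ discriminantIntersection K n) :
    ((Submodule.span K {α} ⊔ diagonal K n : Submodule K (Fin n → K)) : Set (Fin n → K)) ⊆
      discriminantIntersection K n := by
  intro x hx
  obtain ⟨y, hy, d, hd, rfl⟩ := Submodule.mem_sup.1 hx
  obtain ⟨c, rfl⟩ := Submodule.mem_span_singleton.1 hy
  exact smul_add_mem_discriminantIntersection hα c hd

end CasasAlvero

theorem corollary4p9 {K : Type*} [Field K] [IsAlgClosed K] (n : ℕ)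
    (hdim : CasasAlvero.algebraicDim (CasasAlvero.discriminantIntersection K n) = 2) :
    (∃ S : Finset (Submodule K (Fin n → K)),
      (∀ W ∈ S, Module.finrank K W = 2 ∧
        ∃ α ∈ CasasAlvero.discriminantIntersection K n, α ∉ CasasAlvero.diagonal K n ∧
          W = Submodule.span K {α} ⊔ CasasAlvero.diagonal K n) ∧
      CasasAlvero.discriminantIntersection K n = ⋃ W ∈ S, (W : Set (Fin n → K))) ∧
    ∀ τ : Equiv.Perm (Fin n),
      (fun x : Fin n → K => fun l => x (τ⁻¹ l)) '' CasasAlvero.discriminantIntersection K n =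
        CasasAlvero.discriminantIntersection K n := by
  classical
  constructor
  · obtain ⟨β, hβ, hβd⟩ : ∃ β ∈ CasasAlvero.discriminantIntersection K n,
        β ∉ CasasAlvero.diagonal K n := by
      refine Set.not_subset.1 fun h => ?_
      have := CasasAlvero.algebraicDim_le_one_of_subset_diagonal h
      rw [hdim] at this
      exact absurd this (by decide)
    have hn : n ≠ 0 := by
      rintro rfl
      exact hβd ⟨0, fun l => l.elim0⟩
    let T : Set (Submodule K (Fin n → K)) :=
      {W | ∃ α ∈ CasasAlvero.discriminantIntersection K n, α ∉ CasasAlvero.diagonal K n ∧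
        W = Submodule.span K {α} ⊔ CasasAlvero.diagonal K n}
    have hT : T.Finite := by
      by_contra hT
      have : (3 : WithBot ℕ∞) ≤ CasasAlvero.algebraicDim (CasasAlvero.discriminantIntersection K n) :=
        three_le_ringKrullDim_of_infinite_submodules (CasasAlvero.diagonal_ne_bot K hn) hT
          (by
            rintro _ ⟨α, hα, -, rfl⟩
            exact CasasAlvero.span_sup_diagonal_subset hα)
          (by
            rintro _ ⟨α, -, hαd, rfl⟩
            refine lt_of_le_not_ge le_sup_right fun h => hαd (h ?_)
            exact Submodule.mem_sup_left (Submodule.mem_span_singleton_self α))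
      rw [hdim] at this
      exact absurd this (by decide)
    refine ⟨hT.toFinset, fun W hW => ?_, ?_⟩
    · obtain ⟨α, hα, hαd, rfl⟩ := hT.mem_toFinset.1 hW
      exact ⟨CasasAlvero.finrank_span_sup_diagonal hαd, α, hα, hαd, rfl⟩
    · refine subset_antisymm (fun x hx => ?_) (Set.iUnion₂_subset fun W hW => ?_)
      · rw [Set.mem_iUnion₂]
        -- A diagonal point spans no plane of its own with `Δ`; the plane of `β` contains it.
        by_cases hxd : x ∈ CasasAlvero.diagonal K n
        · exact ⟨_, hT.mem_toFinset.2 ⟨β, hβ, hβd, rfl⟩, Submodule.mem_sup_right hxd⟩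
        · exact ⟨_, hT.mem_toFinset.2 ⟨x, hx, hxd, rfl⟩,
            Submodule.mem_sup_left (Submodule.mem_span_singleton_self x)⟩
      · obtain ⟨α, hα, -, rfl⟩ := hT.mem_toFinset.1 hW
        exact CasasAlvero.span_sup_diagonal_subset hα
  · intro τ
    refine subset_antisymm ?_ fun x hx => ?_
    · rintro _ ⟨x, hx, rfl⟩
      exact CasasAlvero.comp_perm_mem_discriminantIntersection hx τ⁻¹
    · exact ⟨x ∘ τ, CasasAlvero.comp_perm_mem_discriminantIntersection hx τ, by ext l; simp⟩
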